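/- **Setting.** Let $D\in(0,\infty)$, $\mathcal D=(0,D)^2$, and let $\partial\mathcal D=\Gamma_1\,\dot\cup\,\Gamma_2$ be a decomposition into two disjoint Borel sets, where $\Gamma_1$ has positive arc length. Let $V=\{v\in H^1(\mathcal D): Tv=0 \text{ a.e. on }\Gamma_1\}$, where $T$ is the trace operator, with $\|v\|_V^2=\|v\|_{L^2(\mathcal D)}^2+\|\nabla v\|_{L^2(\mathcal D)}^2$. Let $(\Omega,\mathcal F,\mathbb P)$ be a probability space and let the following be given: * $\bar a:\mathcal D\to(0,\infty)$ deterministic and continuous with $0<\bar a_-\le\bar a\le\bar a_+<\infty$ on $\mathcal D$, for constants $\bar a_\pm$; * continuous functions $\Phi_1,\Phi_2:\mathbb R\to[0,\infty)$; * zero-mean Gaussian random fields $W_1$ on $[0,D]^2$ and $W_2$ on $[0,\infty)^2$ with $\mathbb P$-a.s. continuous paths; * Lévy subordinators $l_1,l_2$ on $[0,D]$ (a.s. non-decreasing processes with $l_j(0)=0$ a.s. and with independent and stationary increments, continuous in probability), each independent of $W_1$ and of $W_2$. For $K,A\in(0,\infty)$ put $\chi_K(z)=\min(z,K)$ and $$a_K(\omega,x,y)=\bar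 a(x,y)+\Phi_1(W_1(\omega,x,y))+\Phi_2\big(W_2(\omega,\chi_K(l_1(\omega,x)),\chi_K(l_2(\omega,y)))\big),\qquad a_{K,A}=\min(a_K,A),$$ $$a_{K,+}(\omega)=\max\Big\{1,\ \operatorname*{ess\,sup}_{(x,y)\in\mathcal D}a_K(\omega,x,y)\Big\}.$$ Let $f\in L^q(\Omega;L^2(\mathcal D))$ and $g\in L^q(\Omega;L^2(\Gamma_2))$ for some $q\in[1,\infty)$. Let $u_K,u_{K,A}:\Omega\to V$ be pathwise weak solutions of the mixed boundary value problems with coefficients $a_K$ and $a_{K,A}$, i.e. for $\mathbb P$-a.e. $\omega$ and all $v\in V$, $$\int_{\mathcal D}a\,\nabla u\cdot\nabla v\,dx=\int_{\mathcal D}f(\omega)\,v\,dx+\int_{\Gamma_2}g(\omega)\,Tv\,ds$$ holds with $(a,u)=(a_K(\omega,\cdot),u_K(\omega))$ and with $(a,u)=(a_{K,A}(\omega,\cdot),u_{K,A}(\omega))$. **Lemma 5.2.** There is a constant $C=C(\bar a_-,\mathcal D)>0$, depending only on $\bar a_-$ and on the domain $\mathcal D$ with its boundary decomposition $(\Gamma_1,\Gamma_2)$,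 such that for all data as above and $\mathbb P$-almost every $\omega\in\Omega$, $$a_{K,+}(\omega)<\infty\quad\text{and}\quad \|u_K(\omega)-u_{K,A}(\omega)\|_V\le a_{K,+}(\omega)\,C(\bar a_-,\mathcal D)\,\|\nabla u_K(\omega)-\nabla u_{K,A}(\omega)\|_{L^2(\mathcal D)} .$$ -/

import Mathlib

open MeasureTheory ProbabilityTheory Filter Topology
open scoped ENNReal

noncomputable section

/-- The Euclidean plane. -/
abbrev Plane : Type := EuclideanSpace ℝ (Fin 2)

/-! ### The domain -/

/-- The open square `(0, D)²`. -/
def openSquare (D : ℝ) : Set Plane := {x | ∀ i, x i ∈ Set.Ioo 0 D}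

/-- The closed square `[0, D]²`. -/
def closedSquare (D : ℝ) : Set Plane := {x | ∀ i, x i ∈ Set.Icc 0 D}

/-- The closed quadrant `[0, ∞)²`. -/
def quadrant : Set Plane := {x | ∀ i, 0 ≤ x i}

/-- Lebesgue measure on the open square. -/
abbrev squareMeasure (D : ℝ) : Measure Plane := volume.restrict (openSquare D)

/-- Arc length on a subset of the boundary: one-dimensional Hausdorff measure. -/
abbrev arcLength (s : Set Plane) : Measure Plane := (Measure.hausdorffMeasure 1).restrict s

/-! ### The Sobolev space `H¹`, traces, and the space `V` -/

/-- `G` is the weak (distributional) gradient of `v` on the open square `(0, D)²`. -/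
def IsWeakGradient (D : ℝ) (v : Plane → ℝ) (G : Plane → Plane) : Prop :=
  ∀ φ : Plane → ℝ, ContDiff ℝ (⊤ : ℕ∞) φ → HasCompactSupport φ → tsupport φ ⊆ openSquare D →
    ∫ x in openSquare D, v x • gradient φ x = -∫ x in openSquare D, φ x • G x

/-- The Hilbert space of pairs `(v, G)` in `L²((0,D)²; ℝ) × L²((0,D)²; ℝ²)`, with
`‖(v, G)‖² = ‖v‖² + ‖G‖²`. -/
abbrev L2Pair (D : ℝ) : Type :=
  WithLp 2 (Lp ℝ 2 (squareMeasure D) × Lp Plane 2 (squareMeasure D))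

lemma continuous_gradient_of_smooth {φ : Plane → ℝ} (hφ : ContDiff ℝ (⊤ : ℕ∞) φ) :
    Continuous (gradient φ) :=
  (InnerProductSpace.toDual ℝ Plane).symm.continuous.comp (hφ.continuous_fderiv (by simp))

lemma hasCompactSupport_gradient {φ : Plane → ℝ} (hc : HasCompactSupport φ) :
    HasCompactSupport (gradient φ) :=
  (hc.fderiv ℝ).comp_left (g := (InnerProductSpace.toDual ℝ Plane).symm) (map_zero _)

lemma integrable_smul_gradient {D : ℝ} {φ : Plane → ℝ} (hφ : ContDiff ℝ (⊤ : ℕ∞) φ)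
    (hc : HasCompactSupport φ) (v : Lp ℝ 2 (squareMeasure D)) :
    Integrable (fun x => v x • gradient φ x) (squareMeasure D) :=
  memLp_one_iff_integrable.1 (MemLp.smul (p := 2) (q := 2) (r := 1)
    ((continuous_gradient_of_smooth hφ).memLp_of_hasCompactSupport
      (hasCompactSupport_gradient hc)) (Lp.memLp v))

lemma integrable_smul_field {D : ℝ} {φ : Plane → ℝ} (hφ : ContDiff ℝ (⊤ : ℕ∞) φ)
    (hc : HasCompactSupport φ) (G : Lp Plane 2 (squareMeasure D)) :
    Integrable (fun x => φ x • G x) (squareMeasure D) :=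
  memLp_one_iff_integrable.1 (MemLp.smul (p := 2) (q := 2) (r := 1) (Lp.memLp G)
    (hφ.continuous.memLp_of_hasCompactSupport hc))

/-- The Sobolev space `H¹((0,D)²)`: all `v ∈ L²` that have a weak gradient `G ∈ L²`. An element is
stored as the pair `(v, G)`, in which `v` determines `G`, so that the norm is the `H¹` norm
`(∫ |v|² + |∇v|²)^(1/2)`. -/
def sobolevH1 (D : ℝ) : Submodule ℝ (L2Pair D) where
  carrier := {p | IsWeakGradient D p.fst p.snd}
  zero_mem' := by
    intro φ hφ hc hs
    have h1 : ∫ x in openSquare D, ((0 : L2Pair D).fst) x • gradient φ x = 0 := by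
      rw [← integral_zero Plane Plane (μ := squareMeasure D)]
      apply integral_congr_ae
      filter_upwards [Lp.coeFn_zero ℝ 2 (squareMeasure D)] with x hx
      rw [WithLp.zero_fst, hx, Pi.zero_apply, zero_smul]
    have h2 : ∫ x in openSquare D, φ x • ((0 : L2Pair D).snd) x = 0 := by
      rw [← integral_zero Plane Plane (μ := squareMeasure D)]
      apply integral_congr_ae
      filter_upwards [Lp.coeFn_zero Plane 2 (squareMeasure D)] with x hx
      rw [WithLp.zero_snd, hx, Pi.zero_apply, smul_zero]
    rw [h1, h2, neg_zero]
  add_mem' := by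
    intro p q hp hq φ hφ hc hs
    have h1 : ∫ x in openSquare D, ((p + q).fst) x • gradient φ x
        = (∫ x in openSquare D, p.fst x • gradient φ x)
          + ∫ x in openSquare D, q.fst x • gradient φ x := by
      rw [← integral_add (integrable_smul_gradient hφ hc p.fst)
        (integrable_smul_gradient hφ hc q.fst)]
      apply integral_congr_ae
      filter_upwards [Lp.coeFn_add p.fst q.fst] with x hx
      rw [WithLp.add_fst, hx, Pi.add_apply, add_smul]
    have h2 : ∫ x in openSquare D, φ x • ((p + q).snd) x
        = (∫ x in openSquare D, φ x • p.snd x) + ∫ x in openSquare D, φ x • q.snd x := by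
      rw [← integral_add (integrable_smul_field hφ hc p.snd) (integrable_smul_field hφ hc q.snd)]
      apply integral_congr_ae
      filter_upwards [Lp.coeFn_add p.snd q.snd] with x hx
      rw [WithLp.add_snd, hx, Pi.add_apply, smul_add]
    rw [h1, h2, hp φ hφ hc hs, hq φ hφ hc hs, neg_add]
  smul_mem' := by
    intro c p hp φ hφ hc hs
    have h1 : ∫ x in openSquare D, ((c • p).fst) x • gradient φ x
        = c • ∫ x in openSquare D, p.fst x • gradient φ x := by
      rw [← integral_smul]
      apply integral_congr_ae
      filter_upwards [Lp.coeFn_smul c p.fst] with x hx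
      simp [hx, mul_smul]
    have h2 : ∫ x in openSquare D, φ x • ((c • p).snd) x
        = c • ∫ x in openSquare D, φ x • p.snd x := by
      rw [← integral_smul]
      apply integral_congr_ae
      filter_upwards [Lp.coeFn_smul c p.snd] with x hx
      simp [hx, smul_comm c]
    rw [h1, h2, hp φ hφ hc hs, smul_neg]

/-- The graph of the restriction map `φ ↦ φ|_∂` on functions that are smooth up to the boundary:
all triples `((φ, ∇φ), φ|_∂)` with `φ` the restriction of a smooth function on the plane, where
`∂` is the boundary of the open square. -/
def smoothTraceGraph (D : ℝ) :
    Submodule ℝ (L2Pair D × Lp ℝ 2 (arcLength (frontier (openSquare D)))) where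
  carrier := {p | ∃ φ : Plane → ℝ, ContDiff ℝ (⊤ : ℕ∞) φ ∧
    p.1.fst =ᵐ[squareMeasure D] φ ∧ p.1.snd =ᵐ[squareMeasure D] gradient φ ∧
    p.2 =ᵐ[arcLength (frontier (openSquare D))] φ}
  zero_mem' := by
    refine ⟨0, contDiff_const, Lp.coeFn_zero _ _ _, ?_, Lp.coeFn_zero _ _ _⟩
    filter_upwards [Lp.coeFn_zero Plane 2 (squareMeasure D)] with x hx
    exact hx.trans (by simp [gradient])
  add_mem' := by
    rintro p q ⟨φ, hφ, h1, h2, h3⟩ ⟨ψ, hψ, k1, k2, k3⟩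
    refine ⟨φ + ψ, hφ.add hψ, (Lp.coeFn_add _ _).trans (h1.add k1), ?_,
      (Lp.coeFn_add _ _).trans (h3.add k3)⟩
    refine ((Lp.coeFn_add _ _).trans (h2.add k2)).trans (.of_forall fun x => ?_)
    simp [gradient, fderiv_add (hφ.differentiable (by simp) x) (hψ.differentiable (by simp) x)]
  smul_mem' := by
    rintro c p ⟨φ, hφ, h1, h2, h3⟩
    refine ⟨c • φ, hφ.const_smul c, (Lp.coeFn_smul _ _).trans (h1.const_smul c), ?_,
      (Lp.coeFn_smul _ _).trans (h3.const_smul c)⟩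
    refine ((Lp.coeFn_smul _ _).trans (h2.const_smul c)).trans (.of_forall fun x => ?_)
    simp [gradient, fderiv_const_smul (hφ.differentiable (by simp) x)]

/-- `w ∈ L²(∂)` is the trace of `v`, where `∂` is the boundary of the open square. The trace
operator is the continuous extension of `φ ↦ φ|_∂` from the (dense) functions smooth up to the
boundary to `H¹`; its graph is the closure of the graph of that restriction map. -/
def HasTrace (D : ℝ) (v : L2Pair D) (w : Lp ℝ 2 (arcLength (frontier (openSquare D)))) : Prop :=
  (v, w) ∈ (smoothTraceGraph D).topologicalClosure

/-- The space `V` of all `v ∈ H¹((0,D)²)` whose trace vanishes on `Γ₁`, with the norm of `H¹`. -/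
def spaceV (D : ℝ) (Γ₁ : Set Plane) : Submodule ℝ (L2Pair D) where
  carrier := {v | v ∈ sobolevH1 D ∧ ∃ w, HasTrace D v w ∧
    ∀ᵐ x ∂(arcLength (frontier (openSquare D))), x ∈ Γ₁ → w x = 0}
  zero_mem' := by
    refine ⟨zero_mem _, 0, zero_mem (smoothTraceGraph D).topologicalClosure, ?_⟩
    filter_upwards [Lp.coeFn_zero ℝ 2 (arcLength (frontier (openSquare D)))] with x hx _
    exact hx
  add_mem' := by
    rintro p q ⟨hp, w, hw, h0⟩ ⟨hq, z, hz, k0⟩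
    refine ⟨add_mem hp hq, w + z, add_mem (S := Submodule ℝ _) hw hz, ?_⟩
    filter_upwards [Lp.coeFn_add w z, h0, k0] with x hx h k hΓ
    rw [hx, Pi.add_apply, h hΓ, k hΓ, add_zero]
  smul_mem' := by
    rintro c p ⟨hp, w, hw, h0⟩
    refine ⟨Submodule.smul_mem _ c hp, c • w,
      Submodule.smul_mem (smoothTraceGraph D).topologicalClosure c hw, ?_⟩
    filter_upwards [Lp.coeFn_smul c w, h0] with x hx h hΓ
    simp [hx, h hΓ]

/-- The underlying `L²` function of `v ∈ V`. -/
def spaceV.val {D : ℝ} {Γ₁ : Set Plane} (v : spaceV D Γ₁) : Lp ℝ 2 (squareMeasure D) :=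
  (v : L2Pair D).fst

/-- The weak gradient of `v ∈ V`. -/
def spaceV.grad {D : ℝ} {Γ₁ : Set Plane} (v : spaceV D Γ₁) : Lp Plane 2 (squareMeasure D) :=
  (v : L2Pair D).snd

/-- `u ∈ V` is the weak solution of `-∇·(a∇u) = f` in `(0,D)²`, `u = 0` on `Γ₁`,
`a n·∇u = g` on `Γ₂`: it satisfies `∫ a ∇u·∇v = ∫ f v + ∫_{Γ₂} g Tv` for all `v ∈ V`. -/
def IsWeakSolution (D : ℝ) (Γ₁ Γ₂ : Set Plane) (a : Plane → ℝ)
    (f : Lp ℝ 2 (squareMeasure D)) (g : Lp ℝ 2 (arcLength Γ₂)) (u : spaceV D Γ₁) : Prop :=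
  ∀ (v : spaceV D Γ₁) (Tv : Lp ℝ 2 (arcLength (frontier (openSquare D)))),
    HasTrace D (v : L2Pair D) Tv →
      ∫ x in openSquare D, a x * inner ℝ (spaceV.grad u x) (spaceV.grad v x)
        = (∫ x in openSquare D, f x * spaceV.val v x) + ∫ x, g x * Tv x ∂(arcLength Γ₂)

/-! ### Random fields and the diffusion coefficient -/

section Random

variable {Ω : Type*} [MeasurableSpace Ω]

/-- `W` is a zero-mean Gaussian random field on the parameter set `S ⊆ ℝ²` with almost surely
continuous paths. Values at parameters outside `S` are irrelevant. -/
structure IsContinuousCenteredGRF (S : Set Plane) (W : Plane → Ω → ℝ) (P : Measure Ω) :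
    Prop where
  measurable : ∀ x ∈ S, Measurable (W x)
  gaussian : IsGaussianProcess (fun x : S => W x) P
  centered : ∀ x ∈ S, ∫ ω, W x ω ∂P = 0
  continuous_paths : ∀ᵐ ω ∂P, ContinuousOn (fun x => W x ω) S

/-- `l` is a Lévy subordinator on `[0, D]`: an almost surely non-decreasing process with
`l(0) = 0` a.s., independent and stationary increments, and continuous in probability. Values at
times outside `[0, D]` are irrelevant. -/
structure IsLevySubordinator (D : ℝ) (l : ℝ → Ω → ℝ) (P : Measure Ω) : Prop where
  measurable : ∀ t ∈ Set.Icc 0 D, Measurable (l t)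
  start_zero : ∀ᵐ ω ∂P, l 0 ω = 0
  indep_increments : HasIndepIncrements (fun t : Set.Icc 0 D => l t) P
  stationary_increments : ∀ s t, 0 ≤ s → s ≤ t → t ≤ D →
    IdentDistrib (fun ω => l t ω - l s ω) (l (t - s)) P P
  stochastically_continuous : ∀ t ∈ Set.Icc 0 D, TendstoInMeasure P l (𝓝[Set.Icc 0 D] t) (l t)
  monotone_paths : ∀ᵐ ω ∂P, MonotoneOn (fun t => l t ω) (Set.Icc 0 D)

/-- The processes `l` (on `[0, D]`) and `W` (on `S`) are stochastically independent. -/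
def IndepOfField (D : ℝ) (S : Set Plane) (l : ℝ → Ω → ℝ) (W : Plane → Ω → ℝ) (P : Measure Ω) :
    Prop :=
  IndepFun (fun ω (t : Set.Icc 0 D) => l t ω) (fun ω (x : S) => W x ω) P

/-- The data of the jump-diffusion coefficient on `(0, D)²`, the deterministic part of which is
bounded below by `abarMinus`. -/
structure JumpDiffusionData (P : Measure Ω) (D abarMinus : ℝ) where
  abar : Plane → ℝ
  abarPlus : ℝ
  abar_continuous : ContinuousOn abar (openSquare D)
  abar_lower : ∀ x ∈ openSquare D, abarMinus ≤ abar x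
  abar_upper : ∀ x ∈ openSquare D, abar x ≤ abarPlus
  Φ₁ : ℝ → ℝ
  Φ₂ : ℝ → ℝ
  Φ₁_continuous : Continuous Φ₁
  Φ₂_continuous : Continuous Φ₂
  Φ₁_nonneg : ∀ z, 0 ≤ Φ₁ z
  Φ₂_nonneg : ∀ z, 0 ≤ Φ₂ z
  W₁ : Plane → Ω → ℝ
  W₂ : Plane → Ω → ℝ
  W₁_field : IsContinuousCenteredGRF (closedSquare D) W₁ P
  W₂_field : IsContinuousCenteredGRF quadrant W₂ P
  l₁ : ℝ → Ω → ℝ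
  l₂ : ℝ → Ω → ℝ
  l₁_subordinator : IsLevySubordinator D l₁ P
  l₂_subordinator : IsLevySubordinator D l₂ P
  l₁_indep_W₁ : IndepOfField D (closedSquare D) l₁ W₁ P
  l₁_indep_W₂ : IndepOfField D quadrant l₁ W₂ P
  l₂_indep_W₁ : IndepOfField D (closedSquare D) l₂ W₁ P
  l₂_indep_W₂ : IndepOfField D quadrant l₂ W₂ P

/-- The cut function `χ_K(z) = min(z, K)`. -/
def cutoff (K z : ℝ) : ℝ := min z K

variable {P : Measure Ω} {D abarMinus : ℝ}

/-- The coefficient with subordinators cut off at `K`: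
`a_K(ω, x, y) = ā(x, y) + Φ₁(W₁(x, y)) + Φ₂(W₂(χ_K(l₁(x)), χ_K(l₂(y))))`. -/
def JumpDiffusionData.aK (c : JumpDiffusionData P D abarMinus) (K : ℝ) (ω : Ω) (x : Plane) : ℝ :=
  c.abar x + c.Φ₁ (c.W₁ x ω)
    + c.Φ₂ (c.W₂ !₂[cutoff K (c.l₁ (x 0) ω), cutoff K (c.l₂ (x 1) ω)] ω)

/-- The coefficient cut off at `A`: `a_{K,A} = χ_A(a_K)`. -/
def JumpDiffusionData.aKA (c : JumpDiffusionData P D abarMinus) (K A : ℝ) (ω : Ω) (x : Plane) :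
    ℝ :=
  cutoff A (c.aK K ω x)

/-- `a_{K,+}(ω) = max {1, ess sup a_K(ω, ·)}`, as an element of `[0, ∞]`. -/
def JumpDiffusionData.aKPlus (c : JumpDiffusionData P D abarMinus) (K : ℝ) (ω : Ω) : ℝ≥0∞ :=
  max 1 (essSup (fun x => ENNReal.ofReal (c.aK K ω x)) (squareMeasure D))

end Random

end

/-! ### Finiteness of the essential supremum of the coefficient -/

/-! Since `aKPlus` is at least `1`, the estimate is Friedrichs' inequality `‖v‖ ≤ C ‖∇v‖` on `V`,
applied to the difference of the two solutions; the constant comes from the square and `Γ₁` alone.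
Finiteness of `aKPlus` holds because almost every path gives continuous functions on compact sets:
the cut-off confines the argument of `W₂` to `[0, K]²`.

For Friedrichs' inequality, `Γ₁` meets some side of the square in positive length. A smooth `φ` is
compared at an interior point with its values on that part of the side, along paths of one segment
orthogonal to the side and one parallel to it. Averaging over the starting points bounds `∫ φ²` by
the boundary integral of `φ²` plus the Dirichlet integral (`volume_mul_lintegral_sq_le`,
`exists_friedrichs_smooth`). The boundary term is kept because the smooth functions approximating an
element of `V` need not vanish on `Γ₁`. All terms are continuous in the pair (function, trace), so
the inequality passes to the closure that defines `HasTrace`; only then is the trace on `Γ₁` set to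
zero. -/

lemma isOpen_openSquare (D : ℝ) : IsOpen (openSquare D) := by
  have : openSquare D = ⋂ i, (fun x : Plane => x i) ⁻¹' Set.Ioo 0 D := by
    ext x; simp [openSquare]
  rw [this]
  exact isOpen_iInter_of_finite fun i => isOpen_Ioo.preimage (by fun_prop)

lemma isCompact_setOf_forall_mem_Icc (K : ℝ) :
    IsCompact {x : Plane | ∀ i, x i ∈ Set.Icc 0 K} := by
  have h : IsCompact (Set.univ.pi fun _ : Fin 2 => Set.Icc (0 : ℝ) K) :=
    isCompact_univ_pi fun _ => isCompact_Icc
  refine ((h.image (PiLp.continuous_toLp 2 _)).of_isClosed_subset ?_ ?_)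
  · have : {x : Plane | ∀ i, x i ∈ Set.Icc 0 K} =
        ⋂ i, (fun x : Plane => x i) ⁻¹' Set.Icc 0 K := by
      ext x; simp
    rw [this]
    exact isClosed_iInter fun i => isClosed_Icc.preimage (by fun_prop)
  · intro x hx
    exact ⟨x.ofLp, fun i _ => hx i, rfl⟩

lemma ContinuousOn.exists_upper_bound {X : Type*} [TopologicalSpace X] {s : Set X}
    (hs : IsCompact s) {f : X → ℝ} (hf : ContinuousOn f s) : ∃ M, ∀ x ∈ s, f x ≤ M := by
  obtain ⟨M, hM⟩ := (hs.image_of_continuousOn hf).bddAbove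
  exact ⟨M, fun x hx => hM (Set.mem_image_of_mem f hx)⟩

/-- Needed so that the time-changed arguments of `W₂` stay in the quadrant, where its paths are
continuous. -/
lemma IsLevySubordinator.ae_nonneg {Ω : Type*} [MeasurableSpace Ω] {P : Measure Ω} {D : ℝ}
    {l : ℝ → Ω → ℝ} (hl : IsLevySubordinator D l P) :
    ∀ᵐ ω ∂P, ∀ t ∈ Set.Icc 0 D, 0 ≤ l t ω := by
  filter_upwards [hl.start_zero, hl.monotone_paths] with ω h0 hm t ht
  have := hm ⟨le_rfl, ht.1.trans ht.2⟩ ht ht.1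
  simpa [h0] using this

lemma JumpDiffusionData.ae_aKPlus_lt_top {Ω : Type*} [MeasurableSpace Ω] {P : Measure Ω}
    {D abarMinus : ℝ} (c : JumpDiffusionData P D abarMinus) {K : ℝ} (hK : 0 < K) :
    ∀ᵐ ω ∂P, c.aKPlus K ω < ∞ := by
  filter_upwards [c.W₁_field.continuous_paths, c.W₂_field.continuous_paths,
    c.l₁_subordinator.ae_nonneg, c.l₂_subordinator.ae_nonneg] with ω h1 h2 hl1 hl2
  obtain ⟨M1, hM1⟩ := ContinuousOn.exists_upper_bound (isCompact_setOf_forall_mem_Icc D)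
    (c.Φ₁_continuous.comp_continuousOn h1)
  -- The subordinators may jump, so `x ↦ W₂(...)` need not be continuous; the bound is taken over
  -- all of `[0, K]²` instead.
  obtain ⟨M2, hM2⟩ := ContinuousOn.exists_upper_bound (isCompact_setOf_forall_mem_Icc K)
    (c.Φ₂_continuous.comp_continuousOn (h2.mono fun x hx i => (hx i).1))
  refine max_lt ENNReal.one_lt_top (lt_of_le_of_lt (essSup_le_of_ae_le
    (ENNReal.ofReal (c.abarPlus + M1 + M2)) ?_) ENNReal.ofReal_lt_top)
  filter_upwards [ae_restrict_mem (isOpen_openSquare D).measurableSet] with x hx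
  have hx' : ∀ i, x i ∈ Set.Icc 0 D := fun i => Set.Ioo_subset_Icc_self (hx i)
  refine ENNReal.ofReal_le_ofReal (add_le_add (add_le_add (c.abar_upper x hx) (hM1 x hx')) ?_)
  refine hM2 !₂[cutoff K (c.l₁ (x 0) ω), cutoff K (c.l₂ (x 1) ω)] fun i => ?_
  fin_cases i
  · exact ⟨le_min (hl1 _ (hx' 0)) hK.le, min_le_right _ _⟩
  · exact ⟨le_min (hl2 _ (hx' 1)) hK.le, min_le_right _ _⟩

/-! ### Friedrichs' inequality for functions on a product of intervals -/

lemma Real.enorm_sq_eq_ofReal (x : ℝ) : ‖x‖ₑ ^ 2 = ENNReal.ofReal (x ^ 2) := by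
  rw [← ofReal_norm, ← ENNReal.ofReal_pow (norm_nonneg _), Real.norm_eq_abs, sq_abs]

/-- Telescoping `a = b + (c - b) + (a - c)`: in use, `b` is the value on the side, `c` at the corner
of the path, `a` at its end. -/
lemma enorm_sq_le_three_mul (a b c : ℝ) :
    ‖a‖ₑ ^ 2 ≤ 3 * (‖b‖ₑ ^ 2 + ‖c - b‖ₑ ^ 2 + ‖a - c‖ₑ ^ 2) := by
  simp only [Real.enorm_sq_eq_ofReal]
  rw [← ENNReal.ofReal_add (by positivity) (by positivity),
    ← ENNReal.ofReal_add (by positivity) (by positivity),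
    ← ENNReal.ofReal_ofNat, ← ENNReal.ofReal_mul (by positivity)]
  apply ENNReal.ofReal_le_ofReal
  nlinarith [sq_nonneg (b - (c - b)), sq_nonneg (c - b - (a - c)), sq_nonneg (b - (a - c))]

/-- Cauchy–Schwarz against the constant `1`. -/
lemma sq_lintegral_le {α : Type*} [MeasurableSpace α] (μ : Measure α) {f : α → ℝ≥0∞}
    (hf : AEMeasurable f μ) : (∫⁻ x, f x ∂μ) ^ 2 ≤ μ Set.univ * ∫⁻ x, f x ^ 2 ∂μ := by
  have h := ENNReal.lintegral_mul_le_Lp_mul_Lq μ Real.HolderConjugate.two_two hf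
    (aemeasurable_const (b := (1 : ℝ≥0∞)))
  simp only [Pi.mul_apply, mul_one, ENNReal.rpow_two, one_pow, lintegral_one] at h
  calc (∫⁻ x, f x ∂μ) ^ 2
      ≤ ((∫⁻ x, f x ^ 2 ∂μ) ^ (1 / 2 : ℝ) * μ Set.univ ^ (1 / 2 : ℝ)) ^ 2 := by gcongr
    _ = μ Set.univ * ∫⁻ x, f x ^ 2 ∂μ := by
        rw [mul_pow, ← ENNReal.rpow_two, ← ENNReal.rpow_two, ← ENNReal.rpow_mul,
          ← ENNReal.rpow_mul]
        norm_num [mul_comm]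

/-- Fundamental theorem of calculus, then Cauchy–Schwarz on an interval of length `D`. -/
lemma enorm_sub_sq_le_lintegral {f f' : ℝ → ℝ} (hf : ∀ x, HasDerivAt f (f' x) x)
    (hf' : Continuous f') {D a b : ℝ} (ha : a ∈ Set.Icc 0 D) (hb : b ∈ Set.Icc 0 D) :
    ‖f b - f a‖ₑ ^ 2 ≤ ENNReal.ofReal D * ∫⁻ s in Set.Ioo 0 D, ‖f' s‖ₑ ^ 2 := by
  wlog hab : a ≤ b generalizing a b
  · rw [← enorm_neg, neg_sub]
    exact this hb ha (le_of_not_ge hab)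
  have h1 : ‖f b - f a‖ₑ ≤ ∫⁻ s in Set.Ioc a b, ‖f' s‖ₑ := by
    rw [← intervalIntegral.integral_eq_sub_of_hasDerivAt (fun x _ => hf x)
      (hf'.intervalIntegrable _ _), intervalIntegral.integral_of_le hab]
    exact enorm_integral_le_lintegral_enorm _
  have h2 : ∫⁻ s in Set.Ioc a b, ‖f' s‖ₑ ≤ ∫⁻ s in Set.Ioo 0 D, ‖f' s‖ₑ := by
    rw [setLIntegral_congr (Ioo_ae_eq_Ioc (a := (0 : ℝ)) (b := D))]
    exact lintegral_mono_set (Set.Ioc_subset_Ioc ha.1 hb.2)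
  calc ‖f b - f a‖ₑ ^ 2 ≤ (∫⁻ s in Set.Ioo 0 D, ‖f' s‖ₑ) ^ 2 := by gcongr; exact h1.trans h2
    _ ≤ _ := by
      refine (sq_lintegral_le _ hf'.enorm.aemeasurable).trans_eq ?_
      simp

/-- Friedrichs' inequality on the square: the `L²` norm is controlled by the gradient together
with the `L²` norm on a part `E` of positive length of the line at height `c`. -/
lemma volume_mul_lintegral_sq_le {D : ℝ} {p p₁ p₂ : ℝ × ℝ → ℝ} (hp : Continuous p)
    (h₁ : ∀ x y, HasDerivAt (fun s => p (s, y)) (p₁ (x, y)) x)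
    (h₂ : ∀ x y, HasDerivAt (fun s => p (x, s)) (p₂ (x, y)) y)
    (hp₁ : Continuous p₁) (hp₂ : Continuous p₂) {G : ℝ × ℝ → ℝ≥0∞} (hG : Measurable G)
    (hG₁ : ∀ z, ‖p₁ z‖ₑ ^ 2 ≤ G z) (hG₂ : ∀ z, ‖p₂ z‖ₑ ^ 2 ≤ G z)
    {E : Set ℝ} (hEm : MeasurableSet E) (hE : E ⊆ Set.Icc 0 D) {c : ℝ}
    (hc : c ∈ Set.Icc 0 D) :
    volume E * ∫⁻ z in Set.Ioo 0 D ×ˢ Set.Ioo 0 D, ‖p z‖ₑ ^ 2 ≤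
      3 * (ENNReal.ofReal D ^ 2 * (∫⁻ t in E, ‖p (t, c)‖ₑ ^ 2)
        + 2 * ENNReal.ofReal D ^ 3 * ∫⁻ z in Set.Ioo 0 D ×ˢ Set.Ioo 0 D, G z) := by
  set μ : Measure ℝ := volume.restrict (Set.Ioo 0 D) with hμ
  set d := ENNReal.ofReal D
  have hμd : μ Set.univ = d := by simp [hμ, d]
  have hprod : (volume : Measure (ℝ × ℝ)).restrict (Set.Ioo 0 D ×ˢ Set.Ioo 0 D) = μ.prod μ := by
    rw [Measure.volume_eq_prod, Measure.prod_restrict]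
  have hEμ : volume.restrict E ≤ μ := by
    rw [hμ, restrict_Ioo_eq_restrict_Icc]
    exact Measure.restrict_mono hE le_rfl
  have hEd : volume E ≤ d := by
    simpa [hμ, d] using hEμ Set.univ
  rw [hprod]
  set I := ∫⁻ z, G z ∂(μ.prod μ)
  set T := ∫⁻ t in E, ‖p (t, c)‖ₑ ^ 2
  -- Integrate over `t ∈ E` the comparison along the path `(t, c) → (t, y) → (x, y)`. The first
  -- segments sweep out part of the square, giving `d * I`; the second contributes the same line
  -- integral for each `t`, hence a factor `volume E ≤ d`.
  have hpt : ∀ x ∈ Set.Ioo 0 D, ∀ y ∈ Set.Ioo 0 D,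
      volume E * ‖p (x, y)‖ₑ ^ 2 ≤ 3 * (T + d * I + d ^ 2 * ∫⁻ s, G (s, y) ∂μ) := by
    intro x hx y hy
    have hx := Set.Ioo_subset_Icc_self hx
    have hy := Set.Ioo_subset_Icc_self hy
    have hm : Measurable fun t => ∫⁻ r, G (t, r) ∂μ := hG.lintegral_prod_right'
    have hm' : Measurable fun t => ‖p (t, c)‖ₑ ^ 2 :=
      (hp.comp (by fun_prop : Continuous fun t => (t, c))).measurable.enorm.pow_const 2
    calc volume E * ‖p (x, y)‖ₑ ^ 2 = ∫⁻ t in E, ‖p (x, y)‖ₑ ^ 2 := by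
          rw [setLIntegral_const, mul_comm]
      _ ≤ ∫⁻ t in E, 3 * (‖p (t, c)‖ₑ ^ 2 + d * (∫⁻ r, G (t, r) ∂μ)
            + d * ∫⁻ s, G (s, y) ∂μ) := by
          refine setLIntegral_mono' hEm fun t ht => ?_
          refine (enorm_sq_le_three_mul (p (x, y)) (p (t, c)) (p (t, y))).trans ?_
          gcongr
          · refine (enorm_sub_sq_le_lintegral (f := fun s => p (t, s)) (h₂ t) (by fun_prop)
              hc hy).trans ?_
            gcongr
            exact hG₂ _
          · refine (enorm_sub_sq_le_lintegral (f := fun s => p (s, y)) (fun x => h₁ x y)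
              (by fun_prop) (hE ht) hx).trans ?_
            gcongr
            exact hG₁ _
      _ = 3 * (T + d * (∫⁻ t in E, ∫⁻ r, G (t, r) ∂μ) + d * (∫⁻ s, G (s, y) ∂μ) * volume E) := by
          rw [lintegral_const_mul _ (by fun_prop), lintegral_add_left (by fun_prop),
            lintegral_add_left hm', lintegral_const_mul _ hm, setLIntegral_const]
      _ ≤ 3 * (T + d * I + d * (∫⁻ s, G (s, y) ∂μ) * d) := by
          gcongr
          rw [show I = _ from lintegral_prod _ hG.aemeasurable]
          exact lintegral_mono' hEμ le_rfl
      _ = _ := by ring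
  have hm : Measurable fun y => ∫⁻ s, G (s, y) ∂μ := hG.lintegral_prod_left'
  calc volume E * ∫⁻ z, ‖p z‖ₑ ^ 2 ∂(μ.prod μ)
      = ∫⁻ z, volume E * ‖p z‖ₑ ^ 2 ∂(μ.prod μ) := by
        rw [lintegral_const_mul _ (by fun_prop)]
    _ ≤ ∫⁻ z, 3 * (T + d * I + d ^ 2 * ∫⁻ s, G (s, z.2) ∂μ) ∂(μ.prod μ) := by
        rw [← hprod]
        exact setLIntegral_mono' (measurableSet_Ioo.prod measurableSet_Ioo)
          fun z hz => hpt z.1 hz.1 z.2 hz.2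
    _ = 3 * ((T + d * I) * (d * d) + d ^ 2 * (d * ∫⁻ y, ∫⁻ s, G (s, y) ∂μ ∂μ)) := by
        have hm2 : Measurable fun z : ℝ × ℝ => ∫⁻ s, G (s, z.2) ∂μ := hm.comp measurable_snd
        rw [lintegral_const_mul _ (by fun_prop), lintegral_add_left (by fun_prop),
          lintegral_const_mul _ hm2, lintegral_const, ← Set.univ_prod_univ, Measure.prod_prod,
          hμd, lintegral_prod _ hm2.aemeasurable]
        simp only [lintegral_const, hμd, mul_comm _ d]
    _ = _ := by
        rw [← lintegral_prod_symm' _ hG]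
        ring

/-! ### Friedrichs' inequality for smooth functions on the square -/

lemma frontier_openSquare_subset (D : ℝ) :
    frontier (openSquare D) ⊆ closedSquare D \ openSquare D := by
  rw [frontier, (isOpen_openSquare D).interior_eq]
  refine Set.sdiff_subset_sdiff_left (closure_minimal (fun x hx i => ?_)
    (isCompact_setOf_forall_mem_Icc D).isClosed)
  exact Set.Ioo_subset_Icc_self (hx i)

lemma isometry_smul_add {F : Type*} [NormedAddCommGroup F] [NormedSpace ℝ F] {u : F}
    (hu : ‖u‖ = 1) (w : F) : Isometry fun t : ℝ => t • u + w :=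
  Isometry.of_dist_eq fun s t => by
    rw [dist_add_right, dist_eq_norm, ← sub_smul, norm_smul, hu, mul_one, Real.dist_eq,
      Real.norm_eq_abs]

/-- Leaving the frame `u₁, u₂` free treats horizontal and vertical sides at once. The
parametrisation of the line is an isometry, so it carries Lebesgue measure to arc length. -/
lemma lintegral_sq_le_of_line {D : ℝ} {u₁ u₂ : Plane} (hu₁ : ‖u₁‖ = 1) (hu₂ : ‖u₂‖ = 1)
    (he : MeasurePreserving (fun z : ℝ × ℝ => z.1 • u₁ + z.2 • u₂) volume volume)
    (hpre : (fun z : ℝ × ℝ => z.1 • u₁ + z.2 • u₂) ⁻¹' openSquare D =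
      Set.Ioo 0 D ×ˢ Set.Ioo 0 D)
    {Γ : Set Plane} (hΓ : MeasurableSet Γ) {c : ℝ} (hc : c ∈ Set.Icc 0 D)
    (hΓc : ∀ t : ℝ, t • u₁ + c • u₂ ∈ Γ → t ∈ Set.Icc 0 D)
    {φ : Plane → ℝ} (hφ : ContDiff ℝ (⊤ : ℕ∞) φ) :
    Measure.hausdorffMeasure 1 (Γ ∩ Set.range fun t : ℝ => t • u₁ + c • u₂) *
        ∫⁻ x in openSquare D, ‖φ x‖ₑ ^ 2 ≤
      3 * (ENNReal.ofReal D ^ 2 * (∫⁻ x, ‖φ x‖ₑ ^ 2 ∂arcLength Γ)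
        + 2 * ENNReal.ofReal D ^ 3 * ∫⁻ x in openSquare D, ‖gradient φ x‖ₑ ^ 2) := by
  set e : ℝ × ℝ → Plane := fun z => z.1 • u₁ + z.2 • u₂ with he_def
  set L : ℝ → Plane := fun t => t • u₁ + c • u₂ with hL_def
  have hL : Isometry L := isometry_smul_add hu₁ _
  have hLm : Measurable L := hL.continuous.measurable
  have hmap : Measure.map L volume = (Measure.hausdorffMeasure 1).restrict (Set.range L) := by
    rw [← hausdorffMeasure_real]
    exact hL.map_hausdorffMeasure (Or.inl zero_le_one)
  have hec : Continuous e := by fun_prop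
  have hφm : Measurable fun x => ‖φ x‖ₑ ^ 2 := hφ.continuous.measurable.enorm.pow_const 2
  have hgc : Continuous (gradient φ) := continuous_gradient_of_smooth hφ
  have hgm : Measurable fun x => ‖gradient φ x‖ₑ ^ 2 := hgc.measurable.enorm.pow_const 2
  have hSm := (isOpen_openSquare D).measurableSet
  have hvol : volume (L ⁻¹' Γ) = Measure.hausdorffMeasure 1 (Γ ∩ Set.range L) := by
    rw [← Measure.map_apply hLm hΓ, hmap, Measure.restrict_apply hΓ]
  have hT : ∫⁻ t in L ⁻¹' Γ, ‖φ (e (t, c))‖ₑ ^ 2 ≤ ∫⁻ x, ‖φ x‖ₑ ^ 2 ∂arcLength Γ := by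
    change ∫⁻ t in L ⁻¹' Γ, ‖φ (L t)‖ₑ ^ 2 ≤ _
    rw [← setLIntegral_map hΓ hφm hLm, hmap]
    exact lintegral_mono' (Measure.restrict_mono_measure Measure.restrict_le_self Γ) le_rfl
  have hd : ∀ (u w : Plane) (s : ℝ),
      HasDerivAt (fun r : ℝ => φ (r • u + w)) (inner ℝ (gradient φ (s • u + w)) u) s := by
    intro u w s
    have h1 : HasDerivAt (fun r : ℝ => r • u + w) u s := by
      simpa using ((hasDerivAt_id s).smul_const u).add_const w
    rw [inner_gradient_left]
    exact (hφ.differentiable (by simp) _).hasFDerivAt.comp_hasDerivAt s h1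
  have hbound : ∀ (u : Plane) (_ : ‖u‖ = 1) (x : Plane),
      ‖(inner ℝ (gradient φ x) u : ℝ)‖ₑ ^ 2 ≤ ‖gradient φ x‖ₑ ^ 2 := by
    intro u hu x
    gcongr
    rw [enorm_le_iff_norm_le]
    simpa [hu] using norm_inner_le_norm (𝕜 := ℝ) (gradient φ x) u
  have key := volume_mul_lintegral_sq_le (D := D) (p := fun z => φ (e z))
    (p₁ := fun z => inner ℝ (gradient φ (e z)) u₁) (p₂ := fun z => inner ℝ (gradient φ (e z)) u₂)
    (hφ.continuous.comp hec) (fun x y => hd u₁ (y • u₂) x)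
    (fun x y => by simpa only [he_def, add_comm] using hd u₂ (x • u₁) y)
    (by fun_prop) (by fun_prop) (G := fun z => ‖gradient φ (e z)‖ₑ ^ 2)
    (hgm.comp hec.measurable) (fun z => hbound u₁ hu₁ _) (fun z => hbound u₂ hu₂ _)
    (hLm hΓ) (fun t ht => hΓc t ht) hc
  rw [← hpre, he.setLIntegral_comp_preimage hSm hφm,
    he.setLIntegral_comp_preimage hSm hgm, hvol] at key
  exact key.trans (by gcongr)

lemma measurePreserving_toLp_prod :
    MeasurePreserving (fun z : ℝ × ℝ => (!₂[z.1, z.2] : Plane)) volume volume :=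
  (PiLp.volume_preserving_toLp (Fin 2)).comp
    ((volume_preserving_finTwoArrow ℝ).symm MeasurableEquiv.finTwoArrow)

lemma smul_single_add_smul_single (x y : ℝ) :
    x • EuclideanSpace.single (0 : Fin 2) (1 : ℝ) + y • EuclideanSpace.single 1 1 = !₂[x, y] := by
  ext i; fin_cases i <;> simp

lemma measurePreserving_horizontal :
    MeasurePreserving (fun z : ℝ × ℝ => z.1 • EuclideanSpace.single (0 : Fin 2) (1 : ℝ)
      + z.2 • EuclideanSpace.single 1 1) volume volume := by
  simpa only [smul_single_add_smul_single] using measurePreserving_toLp_prod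

lemma measurePreserving_vertical :
    MeasurePreserving (fun z : ℝ × ℝ => z.1 • EuclideanSpace.single (1 : Fin 2) (1 : ℝ)
      + z.2 • EuclideanSpace.single 0 1) volume volume := by
  simp only [add_comm (_ • EuclideanSpace.single (1 : Fin 2) (1 : ℝ)),
    smul_single_add_smul_single]
  exact measurePreserving_toLp_prod.comp Measure.measurePreserving_swap

/-- Four lines cover the boundary, and a finite union of null sets is null. -/
lemma exists_side_hausdorffMeasure_pos {D : ℝ} {Γ : Set Plane}
    (hΓ : Γ ⊆ frontier (openSquare D)) (hpos : 0 < Measure.hausdorffMeasure 1 Γ) :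
    ∃ i : Fin 2, ∃ c : ℝ, (c = 0 ∨ c = D) ∧
      0 < Measure.hausdorffMeasure 1 (Γ ∩ {x : Plane | x i = c}) := by
  by_contra! h
  refine hpos.ne' (measure_mono_null (t := ⋃ i : Fin 2, ((Γ ∩ {x : Plane | x i = 0}) ∪
    (Γ ∩ {x : Plane | x i = D}))) ?_ ?_)
  · intro x hx
    obtain ⟨hcl, hop⟩ := frontier_openSquare_subset D (hΓ hx)
    simp only [openSquare, Set.mem_ofPred_eq, not_forall] at hop
    obtain ⟨i, hi⟩ := hop
    refine Set.mem_iUnion.2 ⟨i, ?_⟩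
    rcases (hcl i).1.eq_or_lt with h0 | h0
    · exact Or.inl ⟨hx, h0.symm⟩
    · refine Or.inr ⟨hx, le_antisymm (hcl i).2 ?_⟩
      by_contra hlt
      exact hi ⟨h0, not_le.1 hlt⟩
  · refine measure_iUnion_null fun i => measure_union_null ?_ ?_
    · exact le_antisymm (h i 0 (Or.inl rfl)) bot_le
    · exact le_antisymm (h i D (Or.inr rfl)) bot_le

/-- Friedrichs' inequality for functions that are smooth up to the boundary. -/
lemma exists_friedrichs_smooth {D : ℝ} (hD : 0 < D) {Γ : Set Plane} (hΓm : MeasurableSet Γ)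
    (hΓ : Γ ⊆ frontier (openSquare D)) (hpos : 0 < Measure.hausdorffMeasure 1 Γ) :
    ∃ C : ℝ≥0∞, C ≠ ∞ ∧ ∀ φ : Plane → ℝ, ContDiff ℝ (⊤ : ℕ∞) φ →
      ∫⁻ x in openSquare D, ‖φ x‖ₑ ^ 2 ≤ C * ((∫⁻ x, ‖φ x‖ₑ ^ 2 ∂arcLength Γ)
        + ∫⁻ x in openSquare D, ‖gradient φ x‖ₑ ^ 2) := by
  suffices h : ∃ ε : ℝ≥0∞, 0 < ε ∧ ∀ φ : Plane → ℝ, ContDiff ℝ (⊤ : ℕ∞) φ →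
      ε * ∫⁻ x in openSquare D, ‖φ x‖ₑ ^ 2 ≤
        3 * (ENNReal.ofReal D ^ 2 * (∫⁻ x, ‖φ x‖ₑ ^ 2 ∂arcLength Γ)
          + 2 * ENNReal.ofReal D ^ 3 * ∫⁻ x in openSquare D, ‖gradient φ x‖ₑ ^ 2) by
    obtain ⟨ε, hε, h⟩ := h
    set d := ENNReal.ofReal D
    have hd : d ≠ ∞ := ENNReal.ofReal_ne_top
    have hM : 3 * (d ^ 2 + 2 * d ^ 3) ≠ ∞ := by finiteness
    -- Capping `ε` at `1` makes the divisor finite without having to show that the side has finite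
    -- length.
    refine ⟨3 * (d ^ 2 + 2 * d ^ 3) / min ε 1, ENNReal.div_ne_top hM (lt_min hε one_pos).ne',
      fun φ hφ => ?_⟩
    rw [ENNReal.mul_comm_div, ← mul_div_assoc, ENNReal.le_div_iff_mul_le
      (Or.inl (lt_min hε one_pos).ne') (Or.inl (min_lt_of_right_lt ENNReal.one_lt_top).ne),
      mul_comm]
    calc min ε 1 * ∫⁻ x in openSquare D, ‖φ x‖ₑ ^ 2
        ≤ ε * ∫⁻ x in openSquare D, ‖φ x‖ₑ ^ 2 := by gcongr; exact min_le_left _ _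
      _ ≤ _ := h φ hφ
      _ ≤ _ := by
        set T := ∫⁻ x, ‖φ x‖ₑ ^ 2 ∂arcLength Γ
        set I := ∫⁻ x in openSquare D, ‖gradient φ x‖ₑ ^ 2
        calc 3 * (d ^ 2 * T + 2 * d ^ 3 * I)
            ≤ 3 * ((d ^ 2 + 2 * d ^ 3) * T + (d ^ 2 + 2 * d ^ 3) * I) := by
              gcongr
              · exact le_self_add
              · exact le_add_self
          _ = _ := by ring
  have hcl : ∀ x ∈ Γ, ∀ i, x i ∈ Set.Icc 0 D := fun x hx =>
    (frontier_openSquare_subset D (hΓ hx)).1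
  obtain ⟨i, c, hc, hpos⟩ := exists_side_hausdorffMeasure_pos hΓ hpos
  have hc' : c ∈ Set.Icc 0 D := by
    rcases hc with rfl | rfl
    exacts [⟨le_rfl, hD.le⟩, ⟨hD.le, le_rfl⟩]
  refine ⟨_, hpos, fun φ hφ => ?_⟩
  -- The index `i` is the coordinate that is constant on the side, so `u₁` must be the other unit
  -- vector.
  fin_cases i
  · convert lintegral_sq_le_of_line (u₁ := EuclideanSpace.single 1 1)
      (u₂ := EuclideanSpace.single 0 1) (by simp) (by simp) measurePreserving_vertical ?_ hΓm hc'
      (fun t ht => by simpa using hcl _ ht 1) hφ using 4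
    · ext x
      constructor
      · intro hx
        refine ⟨x 1, ?_⟩
        beta_reduce
        rw [add_comm, smul_single_add_smul_single]
        ext j; fin_cases j
        · exact Eq.symm hx
        · rfl
      · rintro ⟨t, rfl⟩
        simp
    · ext z
      simp [openSquare, Fin.forall_fin_two, and_comm]
  · convert lintegral_sq_le_of_line (u₁ := EuclideanSpace.single 0 1)
      (u₂ := EuclideanSpace.single 1 1) (by simp) (by simp) measurePreserving_horizontal ?_ hΓm hc'
      (fun t ht => by simpa using hcl _ ht 0) hφ using 4
    · ext x
      constructor
      · intro hx
        refine ⟨x 0, ?_⟩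
        beta_reduce
        rw [smul_single_add_smul_single]
        ext j; fin_cases j
        · rfl
        · exact Eq.symm hx
      · rintro ⟨t, rfl⟩
        simp
    · ext z
      simp [openSquare, Fin.forall_fin_two]

/-! ### Friedrichs' inequality on `V` -/

lemma Lp.ofReal_norm_sq_eq_lintegral {α F : Type*} [MeasurableSpace α] {μ : Measure α}
    [NormedAddCommGroup F] {f : Lp F 2 μ} {g : α → F} (h : f =ᵐ[μ] g) :
    ENNReal.ofReal (‖f‖ ^ 2) = ∫⁻ x, ‖g x‖ₑ ^ 2 ∂μ := by
  rw [ENNReal.ofReal_pow (norm_nonneg _), ofReal_norm, Lp.enorm_def, eLpNorm_congr_ae h,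
    eLpNorm_eq_lintegral_rpow_enorm_toReal (by simp) (by simp)]
  simp only [ENNReal.toReal_ofNat, ENNReal.rpow_two]
  rw [← ENNReal.rpow_two, ← ENNReal.rpow_mul]
  norm_num

lemma HasTrace.mem_of_isClosed {D : ℝ}
    {S : Set (L2Pair D × Lp ℝ 2 (arcLength (frontier (openSquare D))))} (hS : IsClosed S)
    (hsub : ∀ p ∈ smoothTraceGraph D, p ∈ S) {v : L2Pair D}
    {w : Lp ℝ 2 (arcLength (frontier (openSquare D)))} (h : HasTrace D v w) : (v, w) ∈ S := by
  have h' : (v, w) ∈ closure (smoothTraceGraph D :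
      Set (L2Pair D × Lp ℝ 2 (arcLength (frontier (openSquare D))))) := h
  exact closure_minimal hsub hS h'

/-- In use, `R` restricts boundary functions to `Γ`; its boundedness is what lets the boundary term
pass to the limit. -/
lemma isClosed_setOf_norm_fst_sq_le {D : ℝ} {X Y : Type*} [NormedAddCommGroup X]
    [NormedSpace ℝ X] [NormedAddCommGroup Y] [NormedSpace ℝ Y] (R : X →L[ℝ] Y) (C : ℝ) :
    IsClosed {p : L2Pair D × X | ‖p.1.fst‖ ^ 2 ≤ C * (‖R p.2‖ ^ 2 + ‖p.1.snd‖ ^ 2)} :=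
  isClosed_le (by fun_prop) (by fun_prop)

lemma norm_fst_sq_le_of_mem_smoothTraceGraph {D : ℝ} {Γ : Set Plane} (hΓm : MeasurableSet Γ)
    (hΓ : Γ ⊆ frontier (openSquare D)) {C : ℝ≥0∞} (hC : C ≠ ∞)
    (hsmooth : ∀ φ : Plane → ℝ, ContDiff ℝ (⊤ : ℕ∞) φ →
      ∫⁻ x in openSquare D, ‖φ x‖ₑ ^ 2 ≤ C * ((∫⁻ x, ‖φ x‖ₑ ^ 2 ∂arcLength Γ)
        + ∫⁻ x in openSquare D, ‖gradient φ x‖ₑ ^ 2))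
    (p : L2Pair D × Lp ℝ 2 (arcLength (frontier (openSquare D))))
    (hp : p ∈ smoothTraceGraph D) :
    ‖p.1.fst‖ ^ 2 ≤ C.toReal *
      (‖LpToLpRestrictCLM Plane ℝ ℝ (arcLength (frontier (openSquare D))) 2 Γ p.2‖ ^ 2
        + ‖p.1.snd‖ ^ 2) := by
  obtain ⟨φ, hφ, h1, h2, h3⟩ := hp
  have hres : (arcLength (frontier (openSquare D))).restrict Γ = arcLength Γ := by
    rw [Measure.restrict_restrict hΓm, Set.inter_eq_left.2 hΓ]
  have hR : LpToLpRestrictCLM Plane ℝ ℝ (arcLength (frontier (openSquare D))) 2 Γ p.2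
      =ᵐ[(arcLength (frontier (openSquare D))).restrict Γ] φ :=
    (LpToLpRestrictCLM_coeFn ℝ Γ p.2).trans (ae_restrict_of_ae h3)
  have key := hsmooth φ hφ
  rwa [← ENNReal.ofReal_le_ofReal_iff (by positivity),
    ENNReal.ofReal_mul (by positivity), ENNReal.ofReal_toReal hC,
    ENNReal.ofReal_add (by positivity) (by positivity),
    Lp.ofReal_norm_sq_eq_lintegral h1, Lp.ofReal_norm_sq_eq_lintegral h2,
    Lp.ofReal_norm_sq_eq_lintegral hR, hres]

/-- Friedrichs' inequality on `H¹`, with the trace `w` on `Γ` in place of a boundary condition. -/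
lemma exists_friedrichs_hasTrace {D : ℝ} (hD : 0 < D) {Γ : Set Plane} (hΓm : MeasurableSet Γ)
    (hΓ : Γ ⊆ frontier (openSquare D)) (hpos : 0 < Measure.hausdorffMeasure 1 Γ) :
    ∃ C : ℝ, 0 ≤ C ∧ ∀ (v : L2Pair D) (w : Lp ℝ 2 (arcLength (frontier (openSquare D)))),
      HasTrace D v w → ‖v.fst‖ ^ 2 ≤ C *
        (‖LpToLpRestrictCLM Plane ℝ ℝ (arcLength (frontier (openSquare D))) 2 Γ w‖ ^ 2
          + ‖v.snd‖ ^ 2) := by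
  obtain ⟨C, hC, hsmooth⟩ := exists_friedrichs_smooth hD hΓm hΓ hpos
  exact ⟨C.toReal, ENNReal.toReal_nonneg, fun v w hvw =>
    hvw.mem_of_isClosed (isClosed_setOf_norm_fst_sq_le _ C.toReal)
      (norm_fst_sq_le_of_mem_smoothTraceGraph hΓm hΓ hC hsmooth)⟩

/-- Friedrichs' inequality: an element of `H¹` whose trace vanishes on `Γ` is controlled by its
gradient. -/
lemma exists_friedrichs_spaceV {D : ℝ} (hD : 0 < D) {Γ : Set Plane} (hΓm : MeasurableSet Γ)
    (hΓ : Γ ⊆ frontier (openSquare D)) (hpos : 0 < Measure.hausdorffMeasure 1 Γ) :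
    ∃ C : ℝ, 0 < C ∧ ∀ v : spaceV D Γ, ‖v‖ ≤ C * ‖spaceV.grad v‖ := by
  obtain ⟨C, hC, hF⟩ := exists_friedrichs_hasTrace hD hΓm hΓ hpos
  -- The `H¹` norm squared adds `‖∇v‖²` to `‖v‖² ≤ C ‖∇v‖²`.
  refine ⟨√(C + 1), by positivity, fun v => ?_⟩
  obtain ⟨-, w, hw, h0⟩ := v.2
  have hRw : LpToLpRestrictCLM Plane ℝ ℝ (arcLength (frontier (openSquare D))) 2 Γ w = 0 := by
    refine Lp.ext ?_
    filter_upwards [LpToLpRestrictCLM_coeFn ℝ Γ w, ae_restrict_of_ae h0, ae_restrict_mem hΓm,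
      Lp.coeFn_zero ℝ 2 ((arcLength (frontier (openSquare D))).restrict Γ)] with x hx hx0 hxΓ hz
    rw [hz, hx, hx0 hxΓ]
    rfl
  have hle := hF v w hw
  rw [hRw, norm_zero, zero_pow two_ne_zero, zero_add] at hle
  refine le_of_sq_le_sq ?_ (by positivity)
  rw [mul_pow, Real.sq_sqrt (by positivity), Submodule.coe_norm,
    WithLp.prod_norm_sq_eq_of_L2]
  calc _ ≤ C * ‖(v : L2Pair D).snd‖ ^ 2 + ‖(v : L2Pair D).snd‖ ^ 2 := by gcongr
    _ = (C + 1) * ‖spaceV.grad v‖ ^ 2 := by rw [add_one_mul]; rfl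

/-! ### The estimate for the difference of the two solutions -/

theorem lemma5p2 (D : ℝ) (hD : 0 < D) (Γ₁ Γ₂ : Set Plane)
    (hΓ₁ : MeasurableSet Γ₁) (hΓ₂ : MeasurableSet Γ₂) (hdisj : Disjoint Γ₁ Γ₂)
    (hunion : Γ₁ ∪ Γ₂ = frontier (openSquare D))
    (hpos : 0 < Measure.hausdorffMeasure 1 Γ₁)
    (abarMinus : ℝ) (habar : 0 < abarMinus) :
    ∃ C : ℝ, 0 < C ∧
      ∀ (Ω : Type*) [MeasurableSpace Ω] (P : Measure Ω) [IsProbabilityMeasure P]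
        (c : JumpDiffusionData P D abarMinus) (K A : ℝ), 0 < K → 0 < A →
      ∀ (q : ℝ≥0∞), 1 ≤ q → q ≠ ∞ →
      ∀ (f : Ω → Lp ℝ 2 (squareMeasure D)) (g : Ω → Lp ℝ 2 (arcLength Γ₂)),
        MemLp f q P → MemLp g q P →
      ∀ uK uKA : Ω → spaceV D Γ₁,
        (∀ᵐ ω ∂P, IsWeakSolution D Γ₁ Γ₂ (c.aK K ω) (f ω) (g ω) (uK ω)) →
        (∀ᵐ ω ∂P, IsWeakSolution D Γ₁ Γ₂ (c.aKA K A ω) (f ω) (g ω) (uKA ω)) →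
        ∀ᵐ ω ∂P, c.aKPlus K ω < ∞ ∧
          ‖uK ω - uKA ω‖ ≤
            (c.aKPlus K ω).toReal * C * ‖spaceV.grad (uK ω) - spaceV.grad (uKA ω)‖ := by
  obtain ⟨C, hC, hF⟩ := exists_friedrichs_spaceV hD hΓ₁
    (hunion ▸ Set.subset_union_left) hpos
  refine ⟨C, hC, fun Ω _ P _ c K A hK _ q _ _ f g _ _ uK uKA _ _ => ?_⟩
  filter_upwards [c.ae_aKPlus_lt_top hK] with ω hω
  refine ⟨hω, (hF (uK ω - uKA ω)).trans ?_⟩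
  rw [mul_assoc]
  -- The maximum with `1` in `aKPlus` makes the extra factor harmless; finiteness is needed since
  -- `toReal` sends `∞` to `0`.
  refine le_mul_of_one_le_left (by positivity) ?_
  simpa using ENNReal.toReal_mono hω.ne (le_max_left 1 _ : 1 ≤ c.aKPlus K ω)
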